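/- Fix a field $K$ (coefficients of singular homology) and an o-minimal structure on $\mathbb{R}$. A set $X\subset\mathbb{R}^n$ ($n\ge 1$) is constructible if it is compact and definable. For $f\colon X\to\mathbb{R}$ let $\mathrm{PD}_k(X,f)$ be the degree-$k$ persistence diagram of the sublevel set filtration $\{f\le r\}_{r\in\mathbb{R}}$: the multiset of pairs (birth, death) $\in\mathbb{R}\times(\mathbb{R}\cup\{\infty\})$ of a persistent homology cycle basis, together with the diagonal with infinite multiplicity. The classical persistent homology transform of $X$ is the map $$\mathrm{PHT}(X)\colon S^{n-1}\to\mathcal{D}^n,\qquad v\mapsto(\mathrm{PD}_0(X,h_v),\dots,\mathrm{PD}_{n-1}(X,h_v)),\qquad h_v(x)=x\cdot v,$$ and the height distance-from-flat transform of $X$ is the map $$\mathrm{HPHT}(X)\colon \mathrm{AG}(n-1,n)\to\mathcal{D}^n,\qquad P\mapsto(\mathrm{PD}_0(X,d_P),\dots,\mathrm{PD}_{n-1}(X,d_P)),\qquad d_P(x)=\mathrm{dist}(x,P),$$ on the set of affine hyperplanes of $\mathbb{R}^n$, where $\mathcal{D}$ is the set of persistence diagrams. For $M\in\mathbb{R}$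 let $T_M\colon\mathcal{D}^n\to\mathcal{D}^n$ translate every point of every diagram by $(M,M)$ (with $\infty+M=\infty$). (1) Let $n\ge 1$ and let $X\subset\mathbb{R}^n$ be constructible. There is $M>0$ such that $X$ is contained in the open ball of radius $M$ about the origin, and for every such $M$ the map $T_M$ is injective and $$T_M(\operatorname{im}\mathrm{PHT}(X))\subseteq\operatorname{im}\mathrm{HPHT}(X).$$ (2) The inclusion can be strict: for all $0<a<b$ the annulus $X=\{x\in\mathbb{R}^2 : a\le\|x\|\le b\}$ is constructible, and for every $M>0$ such that $X$ is contained in the open ball of radius $M$ about the origin, $$T_M(\operatorname{im}\mathrm{PHT}(X))\subsetneq\operatorname{im}\mathrm{HPHT}(X).$$ -/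

import Mathlib

noncomputable section

namespace PersistentHomologyTransform

open CategoryTheory AlgebraicTopology

/-! ### o-minimal structures and constructible sets -/

/-- An o-minimal structure on the field `ℝ`. `definable n` is the collection of definable subsets
of `ℝⁿ`; only the indices `n ≥ 1` carry meaning. -/
structure OMinimalStructure where
  definable : (n : ℕ) → Set (Set (Fin n → ℝ))
  union_mem : ∀ n, 1 ≤ n → ∀ A ∈ definable n, ∀ B ∈ definable n, A ∪ B ∈ definable n
  inter_mem : ∀ n, 1 ≤ n → ∀ A ∈ definable n, ∀ B ∈ definable n, A ∩ B ∈ definable n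
  compl_mem : ∀ n, 1 ≤ n → ∀ A ∈ definable n, Aᶜ ∈ definable n
  prod_mem : ∀ n m, 1 ≤ n → 1 ≤ m → ∀ A ∈ definable n, ∀ B ∈ definable m,
    {x : Fin (n + m) → ℝ |
      (fun i => x (Fin.castAdd m i)) ∈ A ∧ (fun j => x (Fin.natAdd n j)) ∈ B} ∈ definable (n + m)
  proj_mem : ∀ n, 1 ≤ n → ∀ A ∈ definable (n + 1),
    (fun (x : Fin (n + 1) → ℝ) (i : Fin n) => x i.castSucc) '' A ∈ definable n
  algebraic_mem : ∀ n, 1 ≤ n → ∀ s : Finset (MvPolynomial (Fin n) ℝ),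
    {x : Fin n → ℝ | ∀ p ∈ s, MvPolynomial.eval x p = 0} ∈ definable n
  /-- The definable subsets of the line are the finite unions of points and intervals
  (an order-connected subset of `ℝ` is the same as a point or an interval, possibly empty). -/
  definable_one_iff : ∀ A : Set (Fin 1 → ℝ), A ∈ definable 1 ↔
    ∃ I : Set (Set ℝ), I.Finite ∧ (∀ J ∈ I, J.OrdConnected) ∧ A = {x | x 0 ∈ ⋃₀ I}

/-- A subset of `ℝⁿ` is constructible if it is definable and compact. -/
def IsConstructible (S : OMinimalStructure) {n : ℕ} (X : Set (EuclideanSpace ℝ (Fin n))) : Prop :=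
  {x : Fin n → ℝ | WithLp.toLp 2 x ∈ X} ∈ S.definable n ∧ IsCompact X

/-! ### Singular chains of a filtration

All filtrations of a space `Y` are handled inside the singular chain complex of `Y` with
coefficients in the field `K`: the chains of a subspace are identified with their image. -/

universe u

section Chains

variable (K : Type u) [Field K] (Y : Type) [TopologicalSpace Y]

/-- The singular chain complex of `Y` with coefficients in `K`. -/
abbrev singularComplex : ChainComplex (ModuleCat.{u} K) ℕ :=
  ((singularChainComplexFunctor (ModuleCat.{u} K)).obj (ModuleCat.of K K)).obj (TopCat.of Y)

variable {Y}

/-- The inclusion of a subspace as a morphism of topological spaces. -/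
def inclusion (A : Set Y) : TopCat.of A ⟶ TopCat.of Y :=
  TopCat.ofHom ⟨Subtype.val, continuous_subtype_val⟩

/-- `C_k(A)`, as a subspace of `C_k(Y)`. -/
def chains (k : ℕ) (A : Set Y) : Submodule K ((singularComplex K Y).X k) :=
  LinearMap.range ((((singularChainComplexFunctor (ModuleCat.{u} K)).obj (ModuleCat.of K K)).map
    (inclusion A)).f k).hom

/-- The `k`-cycles of `A`: the chains of `A` with zero boundary (all chains if `k = 0`). -/
def cycles (k : ℕ) (A : Set Y) : Submodule K ((singularComplex K Y).X k) :=
  chains K k A ⊓ LinearMap.ker ((singularComplex K Y).d k ((ComplexShape.down ℕ).next k)).hom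

/-- The `k`-boundaries of `A`: the image of `C_{k+1}(A)` under the boundary operator. -/
def boundaries (k : ℕ) (A : Set Y) : Submodule K ((singularComplex K Y).X k) :=
  (chains K (k + 1) A).map ((singularComplex K Y).d (k + 1) k).hom

/-- The homology `H_k(A) = cycles / boundaries`, as a subspace of `C_k(Y) / boundaries`. -/
def homology (k : ℕ) (A : Set Y) :
    Submodule K ((singularComplex K Y).X k ⧸ boundaries K k A) :=
  (cycles K k A).map (boundaries K k A).mkQ

/-- The sublevel set `{f ≤ r}`. -/
def sublevel (f : Y → ℝ) (r : ℝ) : Set Y := {y | f y ≤ r}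

/-- `b` is the birth of the chain `c` in the sublevel set filtration of `f`:
the least `r` such that `c` is a chain of `{f ≤ r}`. -/
def IsBirth (f : Y → ℝ) (k : ℕ) (c : (singularComplex K Y).X k) (b : ℝ) : Prop :=
  IsLeast {r : ℝ | c ∈ chains K k (sublevel f r)} b

/-- `d` is the death of the chain `c` in the sublevel set filtration of `f`: the least `r` such
that `c` is a boundary in `{f ≤ r}`, and `d = ∞` if there is no such `r`. -/
def IsDeath (f : Y → ℝ) (k : ℕ) (c : (singularComplex K Y).X k) (d : WithTop ℝ) : Prop :=
  (∃ r : ℝ, d = r ∧ IsLeast {r : ℝ | c ∈ boundaries K k (sublevel f r)} r) ∨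
    (d = ⊤ ∧ {r : ℝ | c ∈ boundaries K k (sublevel f r)} = ∅)

/-- A persistent homology cycle basis in degree `k` for the sublevel set filtration of `f`:
finitely many cycles `c j`, with births `b j` and deaths `d j`, such that at every level `r` the
classes of those cycles that are alive (`b j ≤ r < d j`) form a basis of `H_k({f ≤ r})`. -/
structure IsPersistentCycleBasis (f : Y → ℝ) (k m : ℕ)
    (c : Fin m → (singularComplex K Y).X k) (b : Fin m → ℝ) (d : Fin m → WithTop ℝ) : Prop where
  cycle : ∀ j, (singularComplex K Y).d k ((ComplexShape.down ℕ).next k) (c j) = 0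
  birth : ∀ j, IsBirth K f k (c j) (b j)
  death : ∀ j, IsDeath K f k (c j) (d j)
  linearIndependent : ∀ r : ℝ, LinearIndependent K
    (fun j : {j : Fin m // b j ≤ r ∧ (r : WithTop ℝ) < d j} =>
      (boundaries K k (sublevel f r)).mkQ (c j))
  span_eq : ∀ r : ℝ, Submodule.span K (Set.range
    (fun j : {j : Fin m // b j ≤ r ∧ (r : WithTop ℝ) < d j} =>
      (boundaries K k (sublevel f r)).mkQ (c j))) = homology K k (sublevel f r)

end Chains

/-! ### Persistence diagrams -/

/-- A persistence diagram: a finite multiset of points `(b, d)` with `b < d ≤ ∞`. The points of the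
diagonal, which belong to every diagram with infinite multiplicity, are left implicit. -/
@[ext]
structure PersistenceDiagram where
  points : Multiset (ℝ × WithTop ℝ)
  birth_lt_death : ∀ p ∈ points, (p.1 : WithTop ℝ) < p.2

/-- The translation of the extended plane by the vector `(M, M)`, where `∞ + M = ∞`. -/
def translatePoint (M : ℝ) (p : ℝ × WithTop ℝ) : ℝ × WithTop ℝ :=
  (p.1 + M, p.2 + (M : WithTop ℝ))

/-- Translate every point of a diagram by `(M, M)`. -/
def PersistenceDiagram.translate (M : ℝ) (D : PersistenceDiagram) : PersistenceDiagram where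
  points := D.points.map (translatePoint M)
  birth_lt_death := by
    intro p hp
    obtain ⟨q, hq, rfl⟩ := Multiset.mem_map.1 hp
    have h := D.birth_lt_death q hq
    rcases q with ⟨b, d⟩
    induction d using WithTop.recTopCoe with
    | top => exact WithTop.coe_lt_top (b + M)
    | coe d =>
      have h' : b < d := WithTop.coe_lt_coe.1 h
      exact WithTop.coe_lt_coe.2 (by linarith : b + M < d + M)

section Transform

variable (K : Type u) [Field K] {Y : Type} [TopologicalSpace Y]

open Classical in
/-- `D` is the persistence diagram of `f` in degree `k`: the multiset of the off-diagonal
birth-death pairs of some persistent homology cycle basis. -/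
def IsPersistenceDiagram (f : Y → ℝ) (k : ℕ) (D : PersistenceDiagram) : Prop :=
  ∃ (m : ℕ) (c : Fin m → (singularComplex K Y).X k) (b : Fin m → ℝ) (d : Fin m → WithTop ℝ),
    IsPersistentCycleBasis K f k m c b d ∧
    D.points = ((Finset.univ : Finset (Fin m)).val.map (fun j => (b j, d j))).filter
      (fun p => (p.1 : WithTop ℝ) < p.2)

open Classical in
/-- `PD_k(Y, f)`, the persistence diagram of the sublevel set filtration of `f` in degree `k`.
It does not depend on the cycle basis; the value is the diagram without off-diagonal points if there
is no cycle basis, which does not happen for tame functions. -/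
def PD (f : Y → ℝ) (k : ℕ) : PersistenceDiagram :=
  if h : ∃ D, IsPersistenceDiagram K f k D then h.choose else ⟨0, by simp⟩

/-- The persistent homology transform of `X ⊆ ℝⁿ` with parameter space `P` and filtration
functions `f p : X → ℝ`; it sends `p` to `(PD_0(X, f p), …, PD_{n-1}(X, f p))`. -/
def PHT {n : ℕ} (X : Set (EuclideanSpace ℝ (Fin n))) {P : Type} (f : P → X → ℝ) (p : P) :
    Fin n → PersistenceDiagram :=
  fun k => PD K (f p) k

/-- The affine Grassmannian `AG(m, n)` of `m`-dimensional affine subspaces of `ℝⁿ`. -/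
def AffineGrassmannian (m n : ℕ) : Type :=
  {P : AffineSubspace ℝ (EuclideanSpace ℝ (Fin n)) //
    (P : Set (EuclideanSpace ℝ (Fin n))).Nonempty ∧ Module.finrank ℝ P.direction = m}

/-- The classical transform: parameters `v ∈ S^{n-1}`, filtration by the height `x ↦ x · v`. -/
def classicalPHT {n : ℕ} (X : Set (EuclideanSpace ℝ (Fin n))) :
    Metric.sphere (0 : EuclideanSpace ℝ (Fin n)) 1 → Fin n → PersistenceDiagram :=
  PHT K X (fun v x => inner ℝ (x : EuclideanSpace ℝ (Fin n)) (v : EuclideanSpace ℝ (Fin n)))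

/-- The distance-from-flat transform: parameters `P ∈ AG(m, n)`, filtration by `x ↦ dist(x, P)`. -/
def distancePHT (m : ℕ) {n : ℕ} (X : Set (EuclideanSpace ℝ (Fin n))) :
    AffineGrassmannian m n → Fin n → PersistenceDiagram :=
  PHT K X (fun P x => Metric.infDist (x : EuclideanSpace ℝ (Fin n))
    (P.1 : Set (EuclideanSpace ℝ (Fin n))))

/-- The height transform: the distance-from-flat transform for hyperplanes. -/
def heightPHT {n : ℕ} (X : Set (EuclideanSpace ℝ (Fin n))) :
    AffineGrassmannian (n - 1) n → Fin n → PersistenceDiagram :=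
  distancePHT K (n - 1) X

end Transform

/-- Translate every point of every diagram of a tuple by `(M, M)`. -/
def translateTuple {n : ℕ} (M : ℝ) (D : Fin n → PersistenceDiagram) : Fin n → PersistenceDiagram :=
  fun k => (D k).translate M

/-- The closed planar annulus with radii `a` and `b`, centred at the origin. -/
def annulus (a b : ℝ) : Set (EuclideanSpace ℝ (Fin 2)) := {x | a ≤ ‖x‖ ∧ ‖x‖ ≤ b}

end PersistentHomologyTransform

end

noncomputable section

namespace PersistentHomologyTransform

open CategoryTheory AlgebraicTopology

universe u

/-! ### Finite multisets of off-diagonal points are determined by their persistent Betti numbers -/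

/-! On the open ball of radius `M` about the origin, `x · v > -M` for every unit vector `v`, so the
distance from `x` to the hyperplane `{x · v = -M}` is `x · v + M`. Every height filtration is
therefore a distance filtration up to a constant, and adding `M` to a filtration function translates
its diagrams by `(M, M)` (`PD_add_const`). This is the inclusion. No existence result for cycle
bases of constructible sets is needed, since the default diagram is also compatible with
translation.

`PD` is a choice among diagrams of cycle bases, so computing it requires uniqueness. The number of
points born by `r` and dying after `s` is the rank of `H_k({f ≤ r}) → H_k({f ≤ s})`, which depends
on no basis (`IsPersistentCycleBasis.finrank_map_cycles`), and these numbers determine a finite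
off-diagonal multiset (`eq_of_quadrantCount_eq`). Any explicit cycle basis then computes `PD`.

Strictness is seen in degree 0. Every nonempty height sublevel set of the annulus is path connected,
so the diagram has one point. The distance from a line through the origin vanishes on two segments
whose components first meet at level `a`, so the diagram has the two points `(0, ∞)` and `(0, a)`.
Translation preserves the number of points. The computation rests on the description of 0-boundaries
as the span of differences of points joined by a path. -/

open Classical in
/-- The number of points `(b, d)` with `b ≤ r` and `s < d`. -/
def quadrantCount (P : Multiset (ℝ × WithTop ℝ)) (r s : ℝ) : ℕ :=
  P.countP (fun p => p.1 ≤ r ∧ (s : WithTop ℝ) < p.2)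

/-- If the first point of `P` comes before every point of `Q` (smaller birth, or equal birth and
larger death), then some quadrant distinguishes `P` from `Q`. -/
lemma exists_quadrantCount_ne {P Q : Multiset (ℝ × WithTop ℝ)} {p : ℝ × WithTop ℝ} (hp : p ∈ P)
    (hpd : (p.1 : WithTop ℝ) < p.2)
    (hQ : ∀ q ∈ Q, p.1 < q.1 ∨ p.1 = q.1 ∧ q.2 < p.2) :
    ∃ r s : ℝ, r ≤ s ∧ quadrantCount P r s ≠ quadrantCount Q r s := by
  classical
  obtain ⟨s, hs, hsp, hsq⟩ : ∃ s : ℝ, p.1 ≤ s ∧ (s : WithTop ℝ) < p.2 ∧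
      ∀ q ∈ Q, p.1 = q.1 → q.2 ≤ s := by
    -- Finitely many deaths strictly below `p.2` have a real upper bound still below `p.2`; starting
    -- the induction at `p.1` also keeps `p.1 ≤ s`.
    have hfin : ∀ R : Multiset (ℝ × WithTop ℝ), (∀ q ∈ R, q.2 < p.2) →
        ∃ s : ℝ, p.1 ≤ s ∧ (s : WithTop ℝ) < p.2 ∧ ∀ q ∈ R, q.2 ≤ s := by
      intro R
      induction R using Multiset.induction_on with
      | empty => exact fun _ => ⟨p.1, le_rfl, hpd, by simp⟩
      | cons q R ih =>
        intro h
        obtain ⟨s, h1, h2, h3⟩ := ih fun q' hq' => h q' (Multiset.mem_cons_of_mem hq')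
        have hq := h q (Multiset.mem_cons_self q R)
        obtain ⟨t, ht⟩ := WithTop.ne_top_iff_exists.1 (ne_top_of_lt hq)
        refine ⟨max s t, h1.trans (le_max_left _ _), ?_, ?_⟩
        · rw [WithTop.coe_max]
          exact max_lt h2 (ht ▸ hq)
        · intro q' hq'
          rw [WithTop.coe_max]
          rcases Multiset.mem_cons.1 hq' with rfl | hq'
          · exact ht ▸ le_max_right _ _
          · exact (h3 q' hq').trans (le_max_left _ _)
    obtain ⟨s, h1, h2, h3⟩ := hfin (Q.filter fun q => p.1 = q.1) fun q hq => by
      obtain ⟨hq, he⟩ := Multiset.mem_filter.1 hq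
      rcases hQ q hq with h | h
      · exact absurd he h.ne
      · exact h.2
    exact ⟨s, h1, h2, fun q hq he => h3 q (Multiset.mem_filter.2 ⟨hq, he⟩)⟩
  refine ⟨p.1, s, hs, ?_⟩
  have h1 : 0 < quadrantCount P p.1 s := Multiset.countP_pos.2 ⟨p, hp, le_rfl, hsp⟩
  have h2 : quadrantCount Q p.1 s = 0 := by
    refine Multiset.countP_eq_zero.2 ?_
    rintro q hq ⟨hb, hd⟩
    rcases hQ q hq with h | h
    · exact absurd hb h.not_ge
    · exact absurd hd (hsq q hq h.1).not_gt
  omega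

/-- A minimum for the lexicographic order, ascending in birth and descending in death, the order for
which `exists_quadrantCount_ne` is stated. -/
lemma exists_first_point {P : Multiset (ℝ × WithTop ℝ)} (hP : P ≠ 0) :
    ∃ p ∈ P, ∀ q ∈ P, p.1 < q.1 ∨ p.1 = q.1 ∧ q.2 ≤ p.2 := by
  induction P using Multiset.induction_on with
  | empty => exact absurd rfl hP
  | cons a P ih =>
    by_cases h0 : P = 0
    · subst h0
      exact ⟨a, by simp, by simp⟩
    obtain ⟨p, hp, h⟩ := ih h0
    by_cases hap : a.1 < p.1 ∨ a.1 = p.1 ∧ p.2 ≤ a.2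
    · refine ⟨a, by simp, fun q hq => ?_⟩
      rcases Multiset.mem_cons.1 hq with rfl | hq
      · exact Or.inr ⟨rfl, le_rfl⟩
      · rcases hap with h1 | ⟨h1, h1'⟩ <;> rcases h q hq with h2 | ⟨h2, h2'⟩
        · exact Or.inl (h1.trans h2)
        · exact Or.inl (h2 ▸ h1)
        · exact Or.inl (h1 ▸ h2)
        · exact Or.inr ⟨h1.trans h2, h2'.trans h1'⟩
    · refine ⟨p, by simp [hp], fun q hq => ?_⟩
      rcases Multiset.mem_cons.1 hq with rfl | hq
      · push Not at hap
        rcases hap.1.lt_or_eq with h1 | h1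
        · exact Or.inl h1
        · exact Or.inr ⟨h1, (hap.2 h1.symm).le⟩
      · exact h q hq

/-- If the first points of the two multisets differ, the earlier one precedes all points of the
other multiset and some quadrant separates them. Otherwise the common first point can be cancelled,
and induction on the cardinality finishes. -/
theorem eq_of_quadrantCount_eq {P Q : Multiset (ℝ × WithTop ℝ)}
    (hP : ∀ p ∈ P, (p.1 : WithTop ℝ) < p.2) (hQ : ∀ p ∈ Q, (p.1 : WithTop ℝ) < p.2)
    (h : ∀ r s : ℝ, r ≤ s → quadrantCount P r s = quadrantCount Q r s) : P = Q := by
  classical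
  induction hn : P.card generalizing P Q with
  | zero =>
    obtain rfl := Multiset.card_eq_zero.1 hn
    refine (Multiset.eq_zero_of_forall_notMem fun q hq => ?_).symm
    obtain ⟨r, s, hrs, hne⟩ := exists_quadrantCount_ne hq (hQ q hq) (Q := 0) (by simp)
    exact hne (h r s hrs).symm
  | succ n ih =>
    have hP0 : P ≠ 0 := by rintro rfl; simp at hn
    obtain ⟨p, hp, hpP⟩ := exists_first_point hP0
    have hQ0 : Q ≠ 0 := by
      rintro rfl
      obtain ⟨r, s, hrs, hne⟩ := exists_quadrantCount_ne hp (hP p hp) (Q := 0) (by simp)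
      exact hne (h r s hrs)
    obtain ⟨q, hq, hqQ⟩ := exists_first_point hQ0
    have hpq : p = q := by
      by_contra hne
      have key : (p.1 < q.1 ∨ p.1 = q.1 ∧ q.2 < p.2) ∨ (q.1 < p.1 ∨ q.1 = p.1 ∧ p.2 < q.2) := by
        rcases lt_trichotomy p.1 q.1 with h1 | h1 | h1
        · exact Or.inl (Or.inl h1)
        · rcases lt_trichotomy p.2 q.2 with h2 | h2 | h2
          · exact Or.inr (Or.inr ⟨h1.symm, h2⟩)
          · exact absurd (Prod.ext h1 h2) hne
          · exact Or.inl (Or.inr ⟨h1, h2⟩)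
        · exact Or.inr (Or.inl h1)
      have trans : ∀ {x y z : ℝ × WithTop ℝ}, (x.1 < y.1 ∨ x.1 = y.1 ∧ y.2 < x.2) →
          (y.1 < z.1 ∨ y.1 = z.1 ∧ z.2 ≤ y.2) → (x.1 < z.1 ∨ x.1 = z.1 ∧ z.2 < x.2) := by
        rintro x y z (h1 | ⟨h1, h1'⟩) (h2 | ⟨h2, h2'⟩)
        · exact Or.inl (h1.trans h2)
        · exact Or.inl (h2 ▸ h1)
        · exact Or.inl (h1 ▸ h2)
        · exact Or.inr ⟨h1.trans h2, h2'.trans_lt h1'⟩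
      rcases key with key | key
      · obtain ⟨r, s, hrs, hne⟩ := exists_quadrantCount_ne hp (hP p hp) (Q := Q)
          fun z hz => trans key (hqQ z hz)
        exact hne (h r s hrs)
      · obtain ⟨r, s, hrs, hne⟩ := exists_quadrantCount_ne hq (hQ q hq) (Q := P)
          fun z hz => trans key (hpP z hz)
        exact hne (h r s hrs).symm
    subst hpq
    obtain ⟨P', rfl⟩ := Multiset.exists_cons_of_mem hp
    obtain ⟨Q', rfl⟩ := Multiset.exists_cons_of_mem hq
    rw [ih (P := P') (Q := Q') (fun x hx => hP x (by simp [hx])) (fun x hx => hQ x (by simp [hx]))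
      (fun r s hrs => ?_) (by simpa using hn)]
    have := h r s hrs
    simp only [quadrantCount, Multiset.countP_cons] at this
    simpa [quadrantCount] using this

/-! ### Sublevel sets -/

lemma sublevel_mono {Y : Type} (f : Y → ℝ) {r s : ℝ} (h : r ≤ s) : sublevel f r ⊆ sublevel f s :=
  fun _ hy => le_trans hy h

lemma sublevel_add_const {Y : Type} (f : Y → ℝ) (M r : ℝ) :
    sublevel (fun y => f y + M) r = sublevel f (r - M) := by
  ext y
  exact (le_sub_iff_add_le (a := f y) (b := M) (c := r)).symm

/-! ### Uniqueness of the persistence diagram -/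

section Uniqueness

variable (K : Type u) [Field K] {Y : Type} [TopologicalSpace Y]

lemma chains_mono (k : ℕ) {A B : Set Y} (h : A ⊆ B) : chains K k A ≤ chains K k B := by
  have hc : inclusion A =
      TopCat.ofHom ⟨Set.inclusion h, continuous_inclusion h⟩ ≫ inclusion B := rfl
  rintro _ ⟨x, rfl⟩
  rw [hc, Functor.map_comp, HomologicalComplex.comp_f, ModuleCat.hom_comp]
  exact ⟨_, rfl⟩

lemma boundaries_mono (k : ℕ) {A B : Set Y} (h : A ⊆ B) :
    boundaries K k A ≤ boundaries K k B :=
  Submodule.map_mono (chains_mono K (k + 1) h)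

variable {K}

lemma IsDeath.mem_boundaries {f : Y → ℝ} {k : ℕ} {c : (singularComplex K Y).X k} {d : WithTop ℝ}
    (h : IsDeath K f k c d) {s : ℝ} (hs : d ≤ s) : c ∈ boundaries K k (sublevel f s) := by
  rcases h with ⟨r, rfl, hr⟩ | ⟨rfl, -⟩
  · exact boundaries_mono K k (sublevel_mono f (WithTop.coe_le_coe.1 hs)) hr.1
  · simp at hs

variable {f : Y → ℝ} {k m : ℕ} {c : Fin m → (singularComplex K Y).X k} {b : Fin m → ℝ}
  {d : Fin m → WithTop ℝ}

/-- The left side is the image of `H_k({f ≤ r})` in the quotient at level `s`. Basis classes at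
level `r` that die by level `s` map to zero, and the others are still alive at `s`. -/
lemma IsPersistentCycleBasis.map_cycles_eq_span (h : IsPersistentCycleBasis K f k m c b d)
    {r s : ℝ} (hrs : r ≤ s) :
    (cycles K k (sublevel f r)).map (boundaries K k (sublevel f s)).mkQ =
      Submodule.span K (((boundaries K k (sublevel f s)).mkQ ∘ c) ''
        {j | b j ≤ r ∧ (s : WithTop ℝ) < d j}) := by
  have hB := boundaries_mono K k (sublevel_mono f hrs)
  have hmap : (cycles K k (sublevel f r)).map (boundaries K k (sublevel f s)).mkQ =
      (homology K k (sublevel f r)).map (Submodule.factor hB) := by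
    rw [homology, ← Submodule.map_comp, Submodule.factor_comp_mk]
  rw [hmap, ← h.span_eq r, Submodule.map_span, ← Set.range_comp]
  apply le_antisymm
  · rw [Submodule.span_le]
    rintro _ ⟨⟨j, hj⟩, rfl⟩
    by_cases hd : (s : WithTop ℝ) < d j
    · exact Submodule.subset_span ⟨j, ⟨hj.1, hd⟩, rfl⟩
    · have : (boundaries K k (sublevel f s)).mkQ (c j) = 0 :=
        (Submodule.Quotient.mk_eq_zero _).2 ((h.death j).mem_boundaries (not_lt.1 hd))
      change (boundaries K k (sublevel f s)).mkQ (c j) ∈ _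
      rw [this]
      exact Submodule.zero_mem _
  · rw [Submodule.span_le]
    rintro _ ⟨j, hj, rfl⟩
    exact Submodule.subset_span
      ⟨⟨j, hj.1, (WithTop.coe_le_coe.2 hrs).trans_lt hj.2⟩, rfl⟩

/-- The persistent Betti numbers count the points in a quadrant. -/
lemma IsPersistentCycleBasis.finrank_map_cycles (h : IsPersistentCycleBasis K f k m c b d)
    {r s : ℝ} (hrs : r ≤ s) :
    Module.finrank K ((cycles K k (sublevel f r)).map (boundaries K k (sublevel f s)).mkQ) =
      quadrantCount ((Finset.univ : Finset (Fin m)).val.map (fun j => (b j, d j))) r s := by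
  classical
  have hli : LinearIndepOn K ((boundaries K k (sublevel f s)).mkQ ∘ c)
      {j | b j ≤ r ∧ (s : WithTop ℝ) < d j} := by
    have h' : LinearIndepOn K ((boundaries K k (sublevel f s)).mkQ ∘ c)
      {j | b j ≤ s ∧ (s : WithTop ℝ) < d j} := h.linearIndependent s
    exact h'.mono fun j hj => ⟨hj.1.trans hrs, hj.2⟩
  rw [h.map_cycles_eq_span hrs, Set.image_eq_range]
  have := finrank_span_eq_card (R := K) hli
  rw [this, quadrantCount, Multiset.countP_map, ← Finset.filter_val, Finset.card_val,
    Fintype.card_subtype]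
  rfl

theorem IsPersistenceDiagram.unique {D D' : PersistenceDiagram}
    (h : IsPersistenceDiagram K f k D) (h' : IsPersistenceDiagram K f k D') : D = D' := by
  classical
  obtain ⟨m, c, b, d, hc, hD⟩ := h
  obtain ⟨m', c', b', d', hc', hD'⟩ := h'
  -- A point with birth at most `r ≤ s` and death beyond `s` is off the diagonal, so dropping
  -- diagonal points changes no such count.
  have hfilter : ∀ (P : Multiset (ℝ × WithTop ℝ)) {r s : ℝ}, r ≤ s →
      quadrantCount (P.filter fun p => (p.1 : WithTop ℝ) < p.2) r s = quadrantCount P r s := by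
    intro P r s hrs
    rw [quadrantCount, quadrantCount, Multiset.countP_filter]
    refine Multiset.countP_congr rfl fun p _ => propext ⟨fun hp => hp.1, fun hp => ⟨hp, ?_⟩⟩
    exact (WithTop.coe_le_coe.2 (hp.1.trans hrs)).trans_lt hp.2
  refine PersistenceDiagram.ext (eq_of_quadrantCount_eq D.birth_lt_death D'.birth_lt_death ?_)
  intro r s hrs
  rw [hD, hD']
  refine (hfilter _ hrs).trans (Eq.trans ?_ (hfilter _ hrs).symm)
  rw [← hc.finrank_map_cycles hrs, ← hc'.finrank_map_cycles hrs]

lemma IsPersistenceDiagram.PD_eq {D : PersistenceDiagram} (h : IsPersistenceDiagram K f k D) :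
    PD K f k = D := by
  have hex : ∃ D, IsPersistenceDiagram K f k D := ⟨D, h⟩
  rw [PD, dif_pos hex]
  exact hex.choose_spec.unique h

end Uniqueness

/-! ### Translation of the filtration -/

lemma coe_lt_add_coe_iff (M r : ℝ) (d : WithTop ℝ) :
    (r : WithTop ℝ) < d + (M : WithTop ℝ) ↔ ((r - M : ℝ) : WithTop ℝ) < d := by
  induction d using WithTop.recTopCoe with
  | top => simp only [WithTop.top_add, WithTop.coe_lt_top]
  | coe d =>
    rw [← WithTop.coe_add, WithTop.coe_lt_coe, WithTop.coe_lt_coe, sub_lt_iff_lt_add]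

lemma translatePoint_injective (M : ℝ) : Function.Injective (translatePoint M) := by
  rintro ⟨b, d⟩ ⟨b', d'⟩ h
  simp only [translatePoint, Prod.mk.injEq] at h
  obtain ⟨h1, h2⟩ := h
  refine Prod.ext (by linarith) ?_
  exact (WithTop.add_right_inj WithTop.coe_ne_top).1 h2

lemma PersistenceDiagram.translate_injective (M : ℝ) :
    Function.Injective (PersistenceDiagram.translate M) := fun _ _ h =>
  PersistenceDiagram.ext
    (Multiset.map_injective (translatePoint_injective M) (congrArg PersistenceDiagram.points h))

lemma translateTuple_injective {n : ℕ} (M : ℝ) :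
    Function.Injective (translateTuple (n := n) M) := fun _ _ h =>
  funext fun k => PersistenceDiagram.translate_injective M (congrFun h k)

section Translation

variable {K : Type u} [Field K] {Y : Type} [TopologicalSpace Y] {f : Y → ℝ} {k : ℕ}

lemma isLeast_setOf_sub {p : ℝ → Prop} {b : ℝ} (h : IsLeast {r | p r} b) (M : ℝ) :
    IsLeast {r | p (r - M)} (b + M) := by
  refine ⟨?_, fun r hr => le_sub_iff_add_le.1 (h.2 hr)⟩
  have := h.1
  simpa using this

/-- The same cycles serve: the new filtration at level `r` is the old one at level `r - M`. -/
lemma IsPersistentCycleBasis.add_const {m : ℕ} {c : Fin m → (singularComplex K Y).X k}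
    {b : Fin m → ℝ} {d : Fin m → WithTop ℝ} (h : IsPersistentCycleBasis K f k m c b d) (M : ℝ) :
    IsPersistentCycleBasis K (fun y => f y + M) k m c (fun j => b j + M)
      (fun j => d j + (M : WithTop ℝ)) := by
  have hset : ∀ r : ℝ, {j | b j + M ≤ r ∧ (r : WithTop ℝ) < d j + (M : WithTop ℝ)} =
      {j | b j ≤ r - M ∧ ((r - M : ℝ) : WithTop ℝ) < d j} := fun r => by
    ext j
    rw [Set.mem_ofPred_eq, Set.mem_ofPred_eq, coe_lt_add_coe_iff, le_sub_iff_add_le]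
  refine ⟨h.cycle, fun j => ?_, fun j => ?_, fun r => ?_, fun r => ?_⟩
  · have := isLeast_setOf_sub (h.birth j) M
    simpa only [IsBirth, sublevel_add_const] using this
  · rcases h.death j with ⟨r, hr, hl⟩ | ⟨htop, he⟩
    · refine Or.inl ⟨r + M, by rw [hr, WithTop.coe_add], ?_⟩
      have := isLeast_setOf_sub hl M
      simpa only [sublevel_add_const] using this
    · refine Or.inr ⟨by rw [htop, WithTop.top_add], ?_⟩
      refine Set.eq_empty_of_forall_notMem fun r hr => ?_
      rw [Set.mem_ofPred_eq, sublevel_add_const] at hr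
      exact Set.eq_empty_iff_forall_notMem.1 he (r - M) hr
  · have h' : LinearIndepOn K ((boundaries K k (sublevel f (r - M))).mkQ ∘ c)
      {j | b j ≤ r - M ∧ ((r - M : ℝ) : WithTop ℝ) < d j} := h.linearIndependent (r - M)
    rw [← hset] at h'
    rw [sublevel_add_const]
    exact h'
  · have h' := h.span_eq (r - M)
    have e : Submodule.span K (((boundaries K k (sublevel f (r - M))).mkQ ∘ c) ''
      {j | b j ≤ r - M ∧ ((r - M : ℝ) : WithTop ℝ) < d j}) =
        homology K k (sublevel f (r - M)) := by
      rw [Set.image_eq_range]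
      exact h'
    rw [← hset, Set.image_eq_range] at e
    rw [sublevel_add_const]
    exact e

lemma IsPersistenceDiagram.add_const {D : PersistenceDiagram}
    (h : IsPersistenceDiagram K f k D) (M : ℝ) :
    IsPersistenceDiagram K (fun y => f y + M) k (D.translate M) := by
  classical
  obtain ⟨m, c, b, d, hc, hD⟩ := h
  refine ⟨m, c, _, _, hc.add_const M, ?_⟩
  have hlt : ∀ p : ℝ × WithTop ℝ, ((translatePoint M p).1 : WithTop ℝ) < (translatePoint M p).2 ↔
      (p.1 : WithTop ℝ) < p.2 := fun p => by
    rw [translatePoint, coe_lt_add_coe_iff, add_sub_cancel_right]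
  change D.points.map (translatePoint M) = _
  rw [hD]
  have hmm : (Finset.univ : Finset (Fin m)).val.map (fun j => (b j + M, d j + (M : WithTop ℝ))) =
      ((Finset.univ : Finset (Fin m)).val.map (fun j => (b j, d j))).map (translatePoint M) := by
    rw [Multiset.map_map]
    rfl
  rw [hmm]
  generalize (Finset.univ : Finset (Fin m)).val.map (fun j => (b j, d j)) = P
  rw [Multiset.filter_map]
  congr 1
  exact Multiset.filter_congr fun p _ => (hlt p).symm

theorem PD_add_const (f : Y → ℝ) (k : ℕ) (M : ℝ) :
    PD K (fun y => f y + M) k = (PD K f k).translate M := by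
  by_cases h : ∃ D, IsPersistenceDiagram K f k D
  · obtain ⟨D, hD⟩ := h
    rw [hD.PD_eq, (hD.add_const M).PD_eq]
  · have h' : ¬ ∃ D, IsPersistenceDiagram K (fun y => f y + M) k D := by
      rintro ⟨D, hD⟩
      have := hD.add_const (-M)
      simp only [add_neg_cancel_right] at this
      exact h ⟨_, this⟩
    rw [PD, PD, dif_neg h, dif_neg h']
    rfl

end Translation

/-! ### Singular chains in degrees zero and one -/

section LowDegree

open Simplicial

variable (K : Type u) [Field K] {Y Z : Type} [TopologicalSpace Y] [TopologicalSpace Z]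

/-- The singular chain given by a single simplex with coefficient `1`. -/
def simplexChain {k : ℕ} (σ : (TopCat.toSSet.obj (TopCat.of Y)) _⦋k⦌) : (singularComplex K Y).X k :=
  (SSet.ιChainComplex (R := ModuleCat.of K K) _ σ).hom (1 : K)

lemma map_simplexChain {k : ℕ} (g : TopCat.of Y ⟶ TopCat.of Z)
    (σ : (TopCat.toSSet.obj (TopCat.of Y)) _⦋k⦌) :
    ((((singularChainComplexFunctor (ModuleCat.{u} K)).obj (ModuleCat.of K K)).map g).f k).hom
      (simplexChain K σ) = simplexChain K ((TopCat.toSSet.map g).app _ σ) := by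
  have := SSet.ι_chainComplexMap_f _ _ (TopCat.toSSet.map g) (ModuleCat.of K K) σ
  exact congrArg (fun φ => φ.hom (1 : K)) this

lemma d_simplexChain (σ : (TopCat.toSSet.obj (TopCat.of Y)) _⦋1⦌) :
    ((singularComplex K Y).d 1 0).hom (simplexChain K σ) =
      simplexChain K ((TopCat.toSSet.obj (TopCat.of Y)).δ 0 σ) -
        simplexChain K ((TopCat.toSSet.obj (TopCat.of Y)).δ 1 σ) := by
  have := SSet.ιChainComplex_d (TopCat.toSSet.obj (TopCat.of Y)) (ModuleCat.of K K) σ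
  rw [Fin.sum_univ_two, Fin.val_zero, Fin.val_one, pow_zero, pow_one, one_smul, neg_one_smul,
    ← sub_eq_add_neg] at this
  exact congrArg (fun φ => φ.hom (1 : K)) this

/-- The chain module is a coproduct of copies of `K` over the simplices, so the quotient map by the
span, which kills each simplex, is zero. -/
lemma span_simplexChain (k : ℕ) :
    Submodule.span K (Set.range (simplexChain K (Y := Y) (k := k))) = ⊤ := by
  set N := Submodule.span K (Set.range (simplexChain K (Y := Y) (k := k)))
  have h : ModuleCat.ofHom N.mkQ = 0 := by
    refine SSet.chainComplex_hom_ext (R := ModuleCat.of K K) fun σ => ?_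
    ext
    exact (Submodule.Quotient.mk_eq_zero _).2 (Submodule.subset_span ⟨σ, rfl⟩)
  rw [← Submodule.ker_mkQ N, LinearMap.ker_eq_top]
  exact congrArg ModuleCat.Hom.hom h

lemma chains_eq_span (k : ℕ) (A : Set Y) :
    chains K k A = Submodule.span K (Set.range
      fun σ : (TopCat.toSSet.obj (TopCat.of A)) _⦋k⦌ =>
        simplexChain K ((TopCat.toSSet.map (inclusion A)).app _ σ)) := by
  rw [chains, LinearMap.range_eq_map, ← span_simplexChain, Submodule.map_span, ← Set.range_comp]
  congr 2
  funext σ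
  exact map_simplexChain K _ σ

/-- The `0`-chain given by a point. -/
def pointChain (y : Y) : (singularComplex K Y).X 0 :=
  simplexChain K (TopCat.toSSetObj₀Equiv.symm (y : TopCat.of Y))

variable {K}

lemma toSSet_map_toSSetObj₀Equiv_symm (g : TopCat.of Y ⟶ TopCat.of Z) (y : Y) :
    (TopCat.toSSet.map g).app _ (TopCat.toSSetObj₀Equiv.symm (y : TopCat.of Y)) =
      TopCat.toSSetObj₀Equiv.symm (g y) := by
  rfl

lemma chains_zero_eq_span (A : Set Y) :
    chains K 0 A = Submodule.span K (pointChain K '' A) := by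
  rw [chains_eq_span, Set.image_eq_range]
  congr 1
  ext x
  constructor
  · rintro ⟨σ, rfl⟩
    obtain ⟨y, rfl⟩ := TopCat.toSSetObj₀Equiv.symm.surjective σ
    exact ⟨y, congrArg (simplexChain K) (toSSet_map_toSSetObj₀Equiv_symm (inclusion A) y).symm⟩
  · rintro ⟨y, rfl⟩
    exact ⟨TopCat.toSSetObj₀Equiv.symm (y : TopCat.of A), 
      congrArg (simplexChain K) (toSSet_map_toSSetObj₀Equiv_symm (inclusion A) y)⟩

lemma pointChain_mem_chains {A : Set Y} {y : Y} (hy : y ∈ A) : pointChain K y ∈ chains K 0 A :=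
  chains_zero_eq_span (K := K) A ▸ Submodule.subset_span ⟨y, hy, rfl⟩

lemma d_inclusion_simplexChain (A : Set Y) {y z : TopCat.of A} (γ : (TopCat.of A).Path y z) :
    ((singularComplex K Y).d 1 0).hom (simplexChain K
      ((TopCat.toSSet.map (inclusion A)).app _ (TopCat.toSSetObj₁Equiv.symm γ.hom))) =
      pointChain K (z : A).1 - pointChain K (y : A).1 := by
  rw [d_simplexChain, ← SSet.δ_naturality_apply, ← SSet.δ_naturality_apply,
    TopCat.δ_zero_toSSetObj₁Equiv.symm, TopCat.δ_one_toSSetObj₁Equiv.symm, γ.hom₀, γ.hom₁]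
  rfl

/-- Singular 1-simplices of `A` are paths in `A`, and the boundary of a path is its end minus its
start. -/
lemma boundaries_zero_eq_span (A : Set Y) :
    boundaries K 0 A = Submodule.span K
      {x | ∃ y z : Y, JoinedIn A y z ∧ x = pointChain K z - pointChain K y} := by
  rw [boundaries, chains_eq_span, Submodule.map_span, ← Set.range_comp]
  congr 1
  ext x
  constructor
  · rintro ⟨σ, rfl⟩
    obtain ⟨γ, rfl⟩ := TopCat.toSSetObj₁Equiv.symm.surjective σ
    let p : (TopCat.of A).Path (γ 0) (γ 1) := { hom := γ }
    refine ⟨(γ 0 : A).1, (γ 1 : A).1, ?_, d_inclusion_simplexChain A p⟩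
    rw [joinedIn_iff_joined (γ 0 : A).2 (γ 1 : A).2]
    exact ⟨TopCat.pathEquiv p⟩
  · rintro ⟨y, z, hyz, rfl⟩
    have p : Path (⟨y, hyz.source_mem⟩ : A) ⟨z, hyz.target_mem⟩ :=
      (joinedIn_iff_joined hyz.source_mem hyz.target_mem).1 hyz |>.somePath
    exact ⟨_, d_inclusion_simplexChain A ((TopCat.pathEquiv (X := TopCat.of A)).symm p)⟩

/-- The linear functional on `0`-chains extending a function on points. -/
def pointFunctional (φ : Y → K) : (singularComplex K Y).X 0 →ₗ[K] K :=
  ((SSet.isColimitChainComplexXCofan (TopCat.toSSet.obj (TopCat.of Y)) (ModuleCat.of K K) 0).desc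
    (Limits.Cofan.mk (ModuleCat.of K K) fun σ =>
      ModuleCat.ofHom (LinearMap.lsmul K K (φ (TopCat.toSSetObj₀Equiv σ))))).hom

lemma pointFunctional_pointChain (φ : Y → K) (y : Y) :
    pointFunctional φ (pointChain K y) = φ y := by
  have := (SSet.isColimitChainComplexXCofan (TopCat.toSSet.obj (TopCat.of Y))
    (ModuleCat.of K K) 0).fac (Limits.Cofan.mk (ModuleCat.of K K) fun σ =>
      ModuleCat.ofHom (LinearMap.lsmul K K (φ (TopCat.toSSetObj₀Equiv σ))))
      ⟨TopCat.toSSetObj₀Equiv.symm (y : TopCat.of Y)⟩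
  refine (congrArg (fun ψ => ψ.hom (1 : K)) this).trans ?_
  exact mul_one (φ y)

end LowDegree

lemma sublevel_eq_empty {Y : Type} {f : Y → ℝ} {e : Y} (he : ∀ y, f e ≤ f y) {r : ℝ}
    (hr : r < f e) : sublevel f r = ∅ :=
  Set.eq_empty_of_forall_notMem fun y hy => absurd (hr.trans_le (he y)) (not_lt.2 hy)

lemma mem_sublevel {Y : Type} {f : Y → ℝ} {y : Y} {r : ℝ} (h : f y ≤ r) : y ∈ sublevel f r :=
  h

lemma self_mem_sublevel {Y : Type} (f : Y → ℝ) (e : Y) : e ∈ sublevel f (f e) :=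
  le_refl (f e)

/-! ### Homology and persistence in degree zero -/

section DegreeZero

variable {K : Type u} [Field K] {Y : Type} [TopologicalSpace Y]

lemma pointFunctional_eq_zero_of_mem_boundaries {φ : Y → K} {A : Set Y}
    (hφ : ∀ y z, JoinedIn A y z → φ y = φ z) {c : (singularComplex K Y).X 0}
    (hc : c ∈ boundaries K 0 A) : pointFunctional φ c = 0 := by
  rw [boundaries_zero_eq_span] at hc
  have hle : Submodule.span K {x | ∃ y z : Y, JoinedIn A y z ∧
      x = pointChain K z - pointChain K y} ≤ LinearMap.ker (pointFunctional φ) := by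
    rw [Submodule.span_le]
    rintro _ ⟨y, z, hyz, rfl⟩
    rw [SetLike.mem_coe, LinearMap.mem_ker, map_sub, pointFunctional_pointChain,
      pointFunctional_pointChain, hφ y z hyz, sub_self]
  exact hle hc

lemma pointChain_notMem_boundaries (A : Set Y) (y : Y) : pointChain K y ∉ boundaries K 0 A := by
  intro h
  have := pointFunctional_eq_zero_of_mem_boundaries (φ := fun _ => 1) (fun _ _ _ => rfl) h
  rw [pointFunctional_pointChain] at this
  exact one_ne_zero this

/-- The indicator function of the path component of `y` induces a functional that vanishes on
boundaries and detects points outside that component. -/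
lemma pointChain_sub_mem_boundaries_iff {A : Set Y} {y z : Y} (hy : y ∈ A) :
    pointChain K z - pointChain K y ∈ boundaries K 0 A ↔ JoinedIn A y z := by
  classical
  constructor
  · intro h
    by_contra hyz
    have := pointFunctional_eq_zero_of_mem_boundaries
      (φ := fun x => if JoinedIn A y x then 1 else 0)
      (fun x x' hx => by
        have : JoinedIn A y x ↔ JoinedIn A y x' := ⟨fun h => h.trans hx, fun h => h.trans hx.symm⟩
        simp only [this]) h
    rw [map_sub, pointFunctional_pointChain, pointFunctional_pointChain, if_neg hyz,
      if_pos (JoinedIn.refl hy)] at this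
    simp at this
  · intro h
    rw [boundaries_zero_eq_span]
    exact Submodule.subset_span ⟨y, z, h, rfl⟩

lemma chains_zero_empty : chains K 0 (∅ : Set Y) = ⊥ := by
  rw [chains_zero_eq_span, Set.image_empty, Submodule.span_empty]

/-- Degree 0 has no successor in `ComplexShape.down ℕ`, so `next 0` takes its default value 0 and
the differential vanishes by shape. -/
lemma d_zero_next : ((singularComplex K Y).d 0 ((ComplexShape.down ℕ).next 0)).hom = 0 := by
  rw [HomologicalComplex.shape _ _ _ (by simp)]
  rfl

lemma cycles_zero (A : Set Y) : cycles K 0 A = chains K 0 A := by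
  rw [cycles, d_zero_next, LinearMap.ker_zero, inf_top_eq]

lemma homology_zero_empty : homology K 0 (∅ : Set Y) = ⊥ := by
  rw [homology, cycles_zero, chains_zero_empty, Submodule.map_bot]

lemma homology_zero_eq_span {A E : Set Y} (hE : E ⊆ A) (h : ∀ y ∈ A, ∃ e ∈ E, JoinedIn A e y) :
    homology K 0 A = Submodule.span K ((fun e => (boundaries K 0 A).mkQ (pointChain K e)) '' E) := by
  rw [homology, cycles_zero, chains_zero_eq_span, Submodule.map_span, Set.image_image]
  congr 1
  refine Set.Subset.antisymm ?_ (Set.image_mono hE)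
  rintro _ ⟨y, hy, rfl⟩
  obtain ⟨e, he, hey⟩ := h y hy
  refine ⟨e, he, ((Submodule.Quotient.eq _).2 ?_).symm⟩
  exact (pointChain_sub_mem_boundaries_iff (hE he)).2 hey

lemma isBirth_zero {f : Y → ℝ} {e : Y} (he : ∀ y, f e ≤ f y) {c : (singularComplex K Y).X 0}
    (hc0 : c ≠ 0) (hc : c ∈ chains K 0 (sublevel f (f e))) : IsBirth K f 0 c (f e) := by
  refine ⟨hc, fun r hr => ?_⟩
  by_contra hlt
  change c ∈ chains K 0 (sublevel f r) at hr
  rw [sublevel_eq_empty he (not_le.1 hlt), chains_zero_empty] at hr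
  exact hc0 hr

lemma pointChain_ne_zero (y : Y) : pointChain K y ≠ 0 := fun h =>
  pointChain_notMem_boundaries (K := K) ∅ y (h ▸ Submodule.zero_mem _)

lemma isDeath_pointChain (f : Y → ℝ) (y : Y) : IsDeath K f 0 (pointChain K y) ⊤ :=
  Or.inr ⟨rfl, Set.eq_empty_of_forall_notMem fun _ => pointChain_notMem_boundaries _ y⟩

/-- If all sublevel sets are path connected, with a common point `e`, then the diagram in degree `0`
is a single point at infinity. -/
theorem isPersistenceDiagram_zero_of_joinedIn {f : Y → ℝ} {e : Y}
    (h : ∀ y, JoinedIn (sublevel f (f y)) e y) :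
    IsPersistenceDiagram K f 0
      ⟨{(f e, ⊤)}, fun p hp => by
        rw [Multiset.mem_singleton.1 hp]; exact WithTop.coe_lt_top _⟩ := by
  classical
  have he : ∀ y, f e ≤ f y := fun y => (h y).source_mem
  refine ⟨1, fun _ => pointChain K e, fun _ => f e, fun _ => ⊤, ⟨fun j => ?_, fun j => ?_,
    fun j => isDeath_pointChain f e, fun r => ?_, fun r => ?_⟩, ?_⟩
  · exact LinearMap.congr_fun d_zero_next _
  · exact isBirth_zero he (pointChain_ne_zero e) (pointChain_mem_chains (self_mem_sublevel f e))
  · exact (linearIndependent_subsingleton_index_iff _).2 fun j hj =>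
      pointChain_notMem_boundaries _ e ((Submodule.Quotient.mk_eq_zero _).1 hj)
  · by_cases hr : f e ≤ r
    · rw [homology_zero_eq_span (E := {e}) (Set.singleton_subset_iff.2 (mem_sublevel hr))
        (fun y hy => ⟨e, rfl, (h y).mono (sublevel_mono f hy)⟩), Set.image_singleton]
      congr 1
      have : Nonempty {j : Fin 1 // f e ≤ r ∧ (r : WithTop ℝ) < ⊤} :=
        ⟨0, hr, WithTop.coe_lt_top r⟩
      exact Set.range_const
    · rw [sublevel_eq_empty he (not_le.1 hr), homology_zero_empty]
      have : IsEmpty {j : Fin 1 // f e ≤ r ∧ (r : WithTop ℝ) < ⊤} := ⟨fun j => hr j.2.1⟩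
      rw [Set.range_eq_empty, Submodule.span_empty]
  · change {(f e, ⊤)} = Multiset.filter _ {(f e, ⊤)}
    refine (Multiset.filter_eq_self.2 fun p hp => ?_).symm
    rw [Multiset.mem_singleton.1 hp]
    exact WithTop.coe_lt_top _


/-! ### Two components merging: the cycles `e₀` and `e₁ - e₀` -/

lemma span_pair_sub {V : Type*} [AddCommGroup V] [Module K V] (v w : V) :
    Submodule.span K {v, w - v} = Submodule.span K {v, w} := by
  refine le_antisymm (Submodule.span_le.2 ?_) (Submodule.span_le.2 ?_)
  · rintro _ (rfl | rfl)
    · exact Submodule.subset_span (by simp)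
    · exact Submodule.sub_mem _ (Submodule.subset_span (by simp)) (Submodule.subset_span (by simp))
  · refine Set.insert_subset (Submodule.subset_span (by simp)) (Set.singleton_subset_iff.2 ?_)
    · rw [SetLike.mem_coe, ← sub_add_cancel w v]
      exact Submodule.add_mem _ (Submodule.subset_span (by simp)) (Submodule.subset_span (by simp))

lemma homology_zero_eq_span_pair {A : Set Y} {e₀ e₁ : Y} (h₀ : e₀ ∈ A) (h₁ : e₁ ∈ A)
    (h : ∀ y ∈ A, JoinedIn A e₀ y ∨ JoinedIn A e₁ y) :
    homology K 0 A = Submodule.span K {(boundaries K 0 A).mkQ (pointChain K e₀),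
      (boundaries K 0 A).mkQ (pointChain K e₁ - pointChain K e₀)} := by
  rw [homology_zero_eq_span (E := {e₀, e₁}), Set.image_pair, map_sub, span_pair_sub]
  · rintro _ (rfl | rfl)
    · exact h₀
    · exact h₁
  · intro y hy
    rcases h y hy with h | h
    · exact ⟨e₀, by simp, h⟩
    · exact ⟨e₁, by simp, h⟩

lemma linearIndependent_mkQ_pair {A : Set Y} {e₀ e₁ : Y} (h₀ : e₀ ∈ A) (h : ¬ JoinedIn A e₀ e₁) :
    LinearIndependent K ![(boundaries K 0 A).mkQ (pointChain K e₀),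
      (boundaries K 0 A).mkQ (pointChain K e₁ - pointChain K e₀)] := by
  rw [LinearIndependent.pair_iff]
  intro s t hst
  -- The augmentation, sending every point to 1, isolates `s`; what remains is a multiple of `e₁ -
  -- e₀`, which is no boundary.
  rw [← map_smul, ← map_smul, ← map_add] at hst
  have hb := (Submodule.Quotient.mk_eq_zero _).1 hst
  have hs := pointFunctional_eq_zero_of_mem_boundaries (φ := fun _ => 1) (fun _ _ _ => rfl) hb
  simp only [map_add, map_smul, map_sub, pointFunctional_pointChain, sub_self, smul_eq_mul,
    mul_one, mul_zero, add_zero] at hs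
  refine ⟨hs, by_contra fun ht => ?_⟩
  rw [hs, zero_smul, zero_add] at hb
  exact h ((pointChain_sub_mem_boundaries_iff h₀).1 ((Submodule.smul_mem_iff _ ht).1 hb))

/-- The cycles `e₀` and `e₁ - e₀`. -/
def mergeCycles (K : Type u) [Field K] (e₀ e₁ : Y) : Fin 2 → (singularComplex K Y).X 0 :=
  ![pointChain K e₀, pointChain K e₁ - pointChain K e₀]

/-- The deaths of the cycles `e₀` and `e₁ - e₀` when the two points are joined at level `a`. -/
def mergeDeaths (a : ℝ) : Fin 2 → WithTop ℝ := ![⊤, a]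

lemma alive_eq_univ {β a r : ℝ} (hr : β ≤ r) (hra : r < a) :
    {j | β ≤ r ∧ (r : WithTop ℝ) < mergeDeaths a j} = Set.univ := by
  refine Set.eq_univ_of_forall fun j => ⟨hr, ?_⟩
  fin_cases j
  · exact WithTop.coe_lt_top r
  · exact WithTop.coe_lt_coe.2 hra

lemma alive_eq_singleton {β a r : ℝ} (hr : β ≤ r) (hra : a ≤ r) :
    {j | β ≤ r ∧ (r : WithTop ℝ) < mergeDeaths a j} = {0} := by
  ext j
  fin_cases j
  · exact ⟨fun _ => rfl, fun _ => ⟨hr, WithTop.coe_lt_top r⟩⟩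
  · exact ⟨fun hj => absurd (WithTop.coe_lt_coe.1 hj.2) (not_lt.2 hra),
      fun hj => absurd hj (by simp)⟩

lemma alive_eq_empty {β a r : ℝ} (hr : r < β) :
    {j | β ≤ r ∧ (r : WithTop ℝ) < mergeDeaths a j} = ∅ :=
  Set.eq_empty_of_forall_notMem fun _ hj => absurd hj.1 (not_le.2 hr)

lemma mkQ_comp_mergeCycles (A : Set Y) (e₀ e₁ : Y) :
    (boundaries K 0 A).mkQ ∘ mergeCycles K e₀ e₁ =
      ![(boundaries K 0 A).mkQ (pointChain K e₀),
        (boundaries K 0 A).mkQ (pointChain K e₁ - pointChain K e₀)] := by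
  funext j
  fin_cases j <;> rfl

section Merge

variable {f : Y → ℝ} {e₀ e₁ : Y} {a : ℝ}

lemma le_of_sub_mem_boundaries (ha : f e₀ < a) (hsep : ∀ r < a, ¬ JoinedIn (sublevel f r) e₀ e₁)
    {r : ℝ} (hr : pointChain K e₁ - pointChain K e₀ ∈ boundaries K 0 (sublevel f r)) : a ≤ r := by
  by_contra hlt
  -- Raising the level to at least `f e₀` puts `e₀` in the sublevel set, as the path criterion
  -- requires, and stays below `a`.
  have hle : r ≤ max r (f e₀) := le_max_left _ _
  exact hsep (max r (f e₀)) (max_lt (not_le.1 hlt) ha)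
    ((pointChain_sub_mem_boundaries_iff (K := K) (mem_sublevel (le_max_right r (f e₀)))).1
      (boundaries_mono K 0 (sublevel_mono f hle) hr))

lemma isBirth_sub (hmin : ∀ y, f e₀ ≤ f y) (he : f e₁ = f e₀) (hne : e₀ ≠ e₁) :
    IsBirth K f 0 (pointChain K e₁ - pointChain K e₀) (f e₀) := by
  refine isBirth_zero hmin (fun h0 => ?_) (Submodule.sub_mem _ (pointChain_mem_chains (mem_sublevel he.le))
    (pointChain_mem_chains (self_mem_sublevel f e₀)))
  have hb : pointChain K e₁ - pointChain K e₀ ∈ boundaries K 0 ({e₀} : Set Y) := by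
    rw [h0]
    exact Submodule.zero_mem _
  exact hne ((pointChain_sub_mem_boundaries_iff (Set.mem_singleton e₀)).1 hb).target_mem.symm

lemma linearIndepOn_mergeCycles
    (hsep : ∀ r < a, ¬ JoinedIn (sublevel f r) e₀ e₁) (r : ℝ) :
    LinearIndepOn K ((boundaries K 0 (sublevel f r)).mkQ ∘ mergeCycles K e₀ e₁)
      {j | f e₀ ≤ r ∧ (r : WithTop ℝ) < mergeDeaths a j} := by
  rcases lt_or_ge r (f e₀) with hr | hr
  · rw [alive_eq_empty hr]
    exact linearIndepOn_empty _ _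
  rcases lt_or_ge r a with hra | hra
  · rw [alive_eq_univ hr hra, linearIndepOn_univ_iff, mkQ_comp_mergeCycles]
    exact linearIndependent_mkQ_pair (mem_sublevel hr) (hsep r hra)
  · rw [alive_eq_singleton hr hra, linearIndepOn_singleton_iff]
    exact fun h0 => pointChain_notMem_boundaries _ e₀ ((Submodule.Quotient.mk_eq_zero _).1 h0)

/-- Below `f e₀` the sublevel set is empty; between `f e₀` and `a` the two points reach everything;
from `a` on, `e₀` alone does. -/
lemma span_mergeCycles (he : f e₁ = f e₀)
    (hmin : ∀ y, f e₀ ≤ f y)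
    (h : ∀ y, JoinedIn (sublevel f (f y)) e₀ y ∨ JoinedIn (sublevel f (f y)) e₁ y)
    (hmerge : JoinedIn (sublevel f a) e₀ e₁) (r : ℝ) :
    Submodule.span K (((boundaries K 0 (sublevel f r)).mkQ ∘ mergeCycles K e₀ e₁) ''
      {j | f e₀ ≤ r ∧ (r : WithTop ℝ) < mergeDeaths a j}) = homology K 0 (sublevel f r) := by
  have hj : ∀ y ∈ sublevel f r,
      JoinedIn (sublevel f r) e₀ y ∨ JoinedIn (sublevel f r) e₁ y := fun y hy =>
    (h y).imp (fun h => h.mono (sublevel_mono f hy)) (fun h => h.mono (sublevel_mono f hy))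
  rcases lt_or_ge r (f e₀) with hr | hr
  · rw [alive_eq_empty hr, sublevel_eq_empty hmin hr, homology_zero_empty, Set.image_empty,
      Submodule.span_empty]
  rcases lt_or_ge r a with hra | hra
  · rw [alive_eq_univ hr hra, Set.image_univ, mkQ_comp_mergeCycles, Matrix.range_cons_cons_empty,
      homology_zero_eq_span_pair (mem_sublevel hr) (mem_sublevel (he.trans_le hr)) hj]
  · rw [alive_eq_singleton hr hra, Set.image_singleton, homology_zero_eq_span (E := {e₀})
      (Set.singleton_subset_iff.2 (mem_sublevel hr)), Set.image_singleton]
    · rfl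
    · intro y hy
      refine ⟨e₀, rfl, ?_⟩
      rcases hj y hy with h | h
      · exact h
      · exact (hmerge.mono (sublevel_mono f hra)).trans h

/-- The elder rule: if two points at the minimal level meet every component of every sublevel set
and become connected at the level `a`, then the diagram in degree `0` has exactly two points. -/
theorem isPersistenceDiagram_zero_of_merge (he : f e₁ = f e₀) (ha : f e₀ < a)
    (h : ∀ y, JoinedIn (sublevel f (f y)) e₀ y ∨ JoinedIn (sublevel f (f y)) e₁ y)
    (hmerge : JoinedIn (sublevel f a) e₀ e₁)
    (hsep : ∀ r < a, ¬ JoinedIn (sublevel f r) e₀ e₁) :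
    IsPersistenceDiagram K f 0
      ⟨{(f e₀, ⊤), (f e₀, (a : WithTop ℝ))}, fun p hp => by
        rcases Multiset.mem_cons.1 hp with rfl | hp
        · exact WithTop.coe_lt_top _
        · rw [Multiset.mem_singleton.1 hp]; exact WithTop.coe_lt_coe.2 ha⟩ := by
  classical
  have hmin : ∀ y, f e₀ ≤ f y := fun y =>
    (h y).elim (fun h => h.source_mem) (fun h => he ▸ h.source_mem)
  have hne : e₀ ≠ e₁ := by
    rintro rfl
    exact hsep (f e₀) ha (JoinedIn.refl (self_mem_sublevel f e₀))
  refine ⟨2, mergeCycles K e₀ e₁, fun _ => f e₀, mergeDeaths a, ⟨fun j => ?_, fun j => ?_,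
    fun j => ?_, fun r => linearIndepOn_mergeCycles hsep r, fun r => ?_⟩, ?_⟩
  · exact LinearMap.congr_fun d_zero_next _
  · fin_cases j
    · exact isBirth_zero hmin (pointChain_ne_zero e₀)
        (pointChain_mem_chains (self_mem_sublevel f e₀))
    · exact isBirth_sub hmin he hne
  · fin_cases j
    · exact isDeath_pointChain f e₀
    · exact Or.inl ⟨a, rfl, (pointChain_sub_mem_boundaries_iff (mem_sublevel ha.le)).2 hmerge,
        fun r hr => le_of_sub_mem_boundaries ha hsep hr⟩
  · have := span_mergeCycles (K := K) he hmin h hmerge r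
    rw [Set.image_eq_range] at this
    exact this
  · have : ((Finset.univ : Finset (Fin 2)).val.map fun j => (f e₀, mergeDeaths a j)) =
        {(f e₀, ⊤), (f e₀, (a : WithTop ℝ))} := rfl
    rw [this]
    change {(f e₀, ⊤), (f e₀, (a : WithTop ℝ))} = Multiset.filter _ _
    refine (Multiset.filter_eq_self.2 fun p hp => ?_).symm
    rcases Multiset.mem_cons.1 hp with rfl | hp
    · exact WithTop.coe_lt_top _
    · rw [Multiset.mem_singleton.1 hp]; exact WithTop.coe_lt_coe.2 ha

end Merge

end DegreeZero

/-! ### Hyperplanes -/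

section Hyperplane

variable {n : ℕ} (v : EuclideanSpace ℝ (Fin n)) (t : ℝ)

/-- The hyperplane `{x | x · v = t}`, for a unit vector `v`. -/
def hyperplane : AffineSubspace ℝ (EuclideanSpace ℝ (Fin n)) :=
  AffineSubspace.mk' (t • v) (ℝ ∙ v)ᗮ

variable {v}

lemma mem_hyperplane_iff (hv : ‖v‖ = 1) {x : EuclideanSpace ℝ (Fin n)} :
    x ∈ hyperplane v t ↔ inner ℝ x v = t := by
  rw [hyperplane, AffineSubspace.mem_mk', Submodule.mem_orthogonal_singleton_iff_inner_left,
    vsub_eq_sub, inner_sub_left, real_inner_smul_left, real_inner_self_eq_norm_sq, hv, one_pow,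
    mul_one, sub_eq_zero]

/-- The orthogonal projection of `x` attains the value, and Cauchy–Schwarz bounds the distance to
any other point below by it. -/
lemma infDist_hyperplane (hv : ‖v‖ = 1) (x : EuclideanSpace ℝ (Fin n)) :
    Metric.infDist x (hyperplane v t : Set (EuclideanSpace ℝ (Fin n))) = |inner ℝ x v - t| := by
  have hvv : inner ℝ v v = (1 : ℝ) := by rw [real_inner_self_eq_norm_sq, hv, one_pow]
  have hmem : x - (inner ℝ x v - t) • v ∈ (hyperplane v t : Set (EuclideanSpace ℝ (Fin n))) := by
    rw [SetLike.mem_coe, mem_hyperplane_iff t hv, inner_sub_left, real_inner_smul_left, hvv]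
    ring
  refine le_antisymm ?_ ((Metric.le_infDist ⟨_, hmem⟩).2 fun y hy => ?_)
  · refine (Metric.infDist_le_dist_of_mem hmem).trans_eq ?_
    rw [dist_eq_norm, sub_sub_cancel, norm_smul, hv, mul_one, Real.norm_eq_abs]
  · rw [SetLike.mem_coe, mem_hyperplane_iff t hv] at hy
    rw [← hy, ← inner_sub_left, dist_eq_norm]
    simpa [hv] using abs_real_inner_le_norm (x - y) v

lemma finrank_direction_hyperplane (hv : ‖v‖ = 1) :
    Module.finrank ℝ (hyperplane v t).direction = n - 1 := by
  have hv0 : v ≠ 0 := by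
    rintro rfl
    simp at hv
  have h := Submodule.finrank_add_finrank_orthogonal (ℝ ∙ v)
  rw [finrank_span_singleton hv0, finrank_euclideanSpace_fin] at h
  rw [hyperplane, AffineSubspace.direction_mk']
  omega

/-- The hyperplane `{x | x · v = t}` as a point of the affine Grassmannian. -/
def hyperplanePoint (hv : ‖v‖ = 1) : AffineGrassmannian (n - 1) n :=
  ⟨hyperplane v t, AffineSubspace.mk'_nonempty _ _, finrank_direction_hyperplane t hv⟩

variable (K : Type u) [Field K]

lemma heightPHT_hyperplanePoint (hv : ‖v‖ = 1) (X : Set (EuclideanSpace ℝ (Fin n))) (k : Fin n) :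
    heightPHT K X (hyperplanePoint t hv) k =
      PD K (fun x : X => |inner ℝ (x : EuclideanSpace ℝ (Fin n)) v - t|) k :=
  congrArg (fun f => PD K f k) (funext fun x => infDist_hyperplane t hv x.1)

/-- On a set contained in the open ball of radius `M` the distance from `{x | x · v = -M}` is the
height function shifted by `M`. -/
theorem heightPHT_eq_translateTuple {X : Set (EuclideanSpace ℝ (Fin n))} {M : ℝ}
    (hX : X ⊆ Metric.ball 0 M) (v : Metric.sphere (0 : EuclideanSpace ℝ (Fin n)) 1) :
    heightPHT K X (hyperplanePoint (-M) (norm_eq_of_mem_sphere v)) =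
      translateTuple M (classicalPHT K X v) := by
  funext k
  rw [heightPHT_hyperplanePoint]
  refine Eq.trans ?_ (PD_add_const _ _ M)
  congr 1
  funext x
  rw [sub_neg_eq_add, abs_of_nonneg]
  have h1 := abs_real_inner_le_norm (x : EuclideanSpace ℝ (Fin n)) v
  rw [norm_eq_of_mem_sphere v, mul_one] at h1
  have h2 : ‖(x : EuclideanSpace ℝ (Fin n))‖ < M := mem_ball_zero_iff.1 (hX x.2)
  linarith [neg_abs_le (inner ℝ (x : EuclideanSpace ℝ (Fin n)) (v : EuclideanSpace ℝ (Fin n)))]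

theorem translateTuple_image_range_classicalPHT_subset {X : Set (EuclideanSpace ℝ (Fin n))} {M : ℝ}
    (hX : X ⊆ Metric.ball 0 M) :
    translateTuple M '' Set.range (classicalPHT K X) ⊆ Set.range (heightPHT K X) := by
  rintro _ ⟨_, ⟨v, rfl⟩, rfl⟩
  exact ⟨_, heightPHT_eq_translateTuple K hX v⟩

end Hyperplane

/-! ### Paths in planar annuli -/

section PlanarPaths

lemma joinedIn_of_continuous {X : Type*} [TopologicalSpace X] {F : Set X} {γ : ℝ → X}
    (hγ : Continuous γ) {s t : ℝ} (hF : ∀ u ∈ Set.uIcc s t, γ u ∈ F) : JoinedIn F (γ s) (γ t) := by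
  have h := ((convex_uIcc s t).isPathConnected Set.nonempty_uIcc).joinedIn s Set.left_mem_uIcc t
    Set.right_mem_uIcc
  refine (h.map hγ).mono ?_
  rintro _ ⟨u, hu, rfl⟩
  exact hF u hu

/-- The upper circular arc from `(p, q)` to the point with first coordinate `t`. -/
lemma joinedIn_arc {F : Set (ℝ × ℝ)} {p q : ℝ} (t : ℝ) (hq : 0 ≤ q)
    (hF : ∀ s ∈ Set.uIcc p t, (s, √(p ^ 2 + q ^ 2 - s ^ 2)) ∈ F) :
    JoinedIn F (p, q) (t, √(p ^ 2 + q ^ 2 - t ^ 2)) := by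
  have h := joinedIn_of_continuous (γ := fun s => (s, √(p ^ 2 + q ^ 2 - s ^ 2))) (by fun_prop) hF
  simpa [Real.sqrt_sq hq] using h

/-- The part of the annulus in `ℝ × ℝ` where the first coordinate belongs to `I`. -/
def strip (a b : ℝ) (I : Set ℝ) : Set (ℝ × ℝ) :=
  {z | (a ^ 2 ≤ z.1 ^ 2 + z.2 ^ 2 ∧ z.1 ^ 2 + z.2 ^ 2 ≤ b ^ 2) ∧ z.1 ∈ I}

variable {a b r : ℝ}

lemma joinedIn_strip_reflect {I : Set ℝ} {p q p' q' : ℝ}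
    (h : JoinedIn (strip a b I) (p, q) (p', q')) : JoinedIn (strip a b I) (p, -q) (p', -q') := by
  refine (h.map (f := fun z : ℝ × ℝ => (z.1, -z.2)) (by fun_prop)).mono ?_
  rintro _ ⟨z, ⟨hz, hI⟩, rfl⟩
  exact ⟨by simpa using hz, hI⟩

lemma joinedIn_strip_arc {I : Set ℝ} {p q : ℝ} (t : ℝ) (hq : 0 ≤ q)
    (hpq : (p, q) ∈ strip a b I) (hI : ∀ s ∈ Set.uIcc p t, s ∈ I ∧ s ^ 2 ≤ p ^ 2 + q ^ 2) :
    JoinedIn (strip a b I) (p, q) (t, √(p ^ 2 + q ^ 2 - t ^ 2)) := by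
  refine joinedIn_arc t hq fun s hs => ⟨?_, (hI s hs).1⟩
  simp only
  rw [Real.sq_sqrt (sub_nonneg.2 (hI s hs).2), add_sub_cancel]
  exact hpq.1

/-- Slide along the circle through the point to its leftmost point `(-ρ, 0)`, then radially outward
to `(-b, 0)`: the first coordinate never increases. -/
lemma joinedIn_strip_Iic (hb : 0 < b) {p q : ℝ} (h : (p, q) ∈ strip a b (Set.Iic r)) :
    JoinedIn (strip a b (Set.Iic r)) (p, q) (-b, 0) := by
  wlog hq : 0 ≤ q generalizing q
  · have := joinedIn_strip_reflect (this (q := -q) (by simpa [strip] using h) (by linarith))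
    simpa using this
  obtain ⟨⟨h1, h2⟩, h3⟩ := id h
  simp only [Set.mem_Iic] at h1 h2 h3
  set ρ := √(p ^ 2 + q ^ 2) with hρ
  have hρ0 : 0 ≤ ρ := Real.sqrt_nonneg _
  have hρ2 : ρ ^ 2 = p ^ 2 + q ^ 2 := Real.sq_sqrt (by positivity)
  have hρb : ρ ≤ b := abs_le_of_sq_le_sq' (by linarith) hb.le |>.2
  have hpρ : |p| ≤ ρ := abs_le_of_sq_le_sq (by nlinarith) hρ0
  have hp := abs_le.1 hpρ
  have harc := joinedIn_strip_arc (-ρ) hq h fun s hs => by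
    rw [Set.uIcc_of_ge hp.1] at hs
    refine ⟨hs.2.trans h3, ?_⟩
    rw [← hρ2]
    exact sq_le_sq' hs.1 (hs.2.trans hp.2)
  rw [neg_sq, hρ2, sub_self, Real.sqrt_zero] at harc
  refine harc.trans (joinedIn_of_continuous (γ := fun s : ℝ => (s, (0 : ℝ))) (by fun_prop) ?_)
  intro s hs
  rw [Set.uIcc_of_ge (by linarith)] at hs
  refine ⟨⟨?_, ?_⟩, hs.2.trans (hp.1.trans h3)⟩
  · nlinarith [hs.2]
  · nlinarith [hs.1, hs.2]

/-- Slide along the circle to its top `(0, ρ)`, then radially outward to `(0, b)`: the absolute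
value of the first coordinate never increases. -/
lemma joinedIn_strip_Icc (hb : 0 < b) {p q : ℝ} (h : (p, q) ∈ strip a b (Set.Icc (-r) r))
    (hq : 0 ≤ q) : JoinedIn (strip a b (Set.Icc (-r) r)) (p, q) (0, b) := by
  obtain ⟨⟨h1, h2⟩, h3⟩ := id h
  simp only at h1 h2 h3
  set ρ := √(p ^ 2 + q ^ 2) with hρ
  have hρ0 : 0 ≤ ρ := Real.sqrt_nonneg _
  have hρ2 : ρ ^ 2 = p ^ 2 + q ^ 2 := Real.sq_sqrt (by positivity)
  have hρb : ρ ≤ b := abs_le_of_sq_le_sq' (by linarith) hb.le |>.2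
  have hr : 0 ≤ r := by linarith [h3.1, h3.2]
  have harc := joinedIn_strip_arc 0 hq h fun s hs => by
    refine ⟨Set.uIcc_subset_Icc h3 ⟨by linarith, hr⟩ hs, ?_⟩
    have : s ^ 2 ≤ p ^ 2 := by
      rcases le_total p 0 with hp | hp
      · rw [Set.uIcc_of_le hp] at hs
        nlinarith [hs.1, hs.2]
      · rw [Set.uIcc_of_ge hp] at hs
        nlinarith [hs.1, hs.2]
    nlinarith
  rw [zero_pow two_ne_zero, sub_zero, ← hρ] at harc
  refine harc.trans (joinedIn_of_continuous (γ := fun s : ℝ => ((0 : ℝ), s)) (by fun_prop) ?_)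
  intro s hs
  rw [Set.uIcc_of_le hρb] at hs
  refine ⟨⟨?_, ?_⟩, ⟨by simpa using hr, hr⟩⟩
  · nlinarith [hs.1]
  · nlinarith [hs.1, hs.2]

lemma joinedIn_strip_Icc_neg (hb : 0 < b) {p q : ℝ} (h : (p, q) ∈ strip a b (Set.Icc (-r) r))
    (hq : q ≤ 0) : JoinedIn (strip a b (Set.Icc (-r) r)) (p, q) (0, -b) := by
  have := joinedIn_strip_reflect
    (joinedIn_strip_Icc hb (q := -q) (by simpa [strip] using h) (by linarith))
  simpa using this

end PlanarPaths

/-! ### Sublevel sets of the annulus -/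

section Annulus

/-- The linear isometry `ℝ² → ℝ²` with first axis `v`. -/
def frame (v : EuclideanSpace ℝ (Fin 2)) (z : ℝ × ℝ) : EuclideanSpace ℝ (Fin 2) :=
  !₂[z.1 * v 0 - z.2 * v 1, z.1 * v 1 + z.2 * v 0]

/-- The second coordinate with respect to the frame with first axis `v`. -/
def coheight (v x : EuclideanSpace ℝ (Fin 2)) : ℝ := x 1 * v 0 - x 0 * v 1

lemma continuous_frame (v : EuclideanSpace ℝ (Fin 2)) : Continuous (frame v) := by
  unfold frame
  refine (PiLp.continuous_toLp 2 _).comp (continuous_pi fun i => ?_)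
  fin_cases i
  · simp; fun_prop
  · simp; fun_prop

lemma continuous_coheight (v : EuclideanSpace ℝ (Fin 2)) : Continuous (coheight v) := by
  unfold coheight
  fun_prop

variable {v : EuclideanSpace ℝ (Fin 2)}

lemma sq_add_sq_of_norm_eq_one (hv : ‖v‖ = 1) : v 0 ^ 2 + v 1 ^ 2 = 1 := by
  have := EuclideanSpace.real_norm_sq_eq v
  rw [hv, Fin.sum_univ_two] at this
  linarith

lemma inner_fin_two (x y : EuclideanSpace ℝ (Fin 2)) :
    inner ℝ x y = x 0 * y 0 + x 1 * y 1 := by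
  simp [PiLp.inner_apply, Fin.sum_univ_two, mul_comm]

lemma frame_inner_coheight (hv : ‖v‖ = 1) (x : EuclideanSpace ℝ (Fin 2)) :
    frame v (inner ℝ x v, coheight v x) = x := by
  have h := sq_add_sq_of_norm_eq_one hv
  ext i
  fin_cases i
  · simp [frame, coheight, inner_fin_two]
    linear_combination x 0 * h
  · simp [frame, coheight, inner_fin_two]
    linear_combination x 1 * h

lemma inner_frame (hv : ‖v‖ = 1) (z : ℝ × ℝ) : inner ℝ (frame v z) v = z.1 := by
  have h := sq_add_sq_of_norm_eq_one hv
  simp [frame, inner_fin_two]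
  linear_combination z.1 * h

lemma coheight_frame (hv : ‖v‖ = 1) (z : ℝ × ℝ) : coheight v (frame v z) = z.2 := by
  have h := sq_add_sq_of_norm_eq_one hv
  simp [frame, coheight]
  linear_combination z.2 * h

lemma norm_sq_frame (hv : ‖v‖ = 1) (z : ℝ × ℝ) : ‖frame v z‖ ^ 2 = z.1 ^ 2 + z.2 ^ 2 := by
  have h := sq_add_sq_of_norm_eq_one hv
  rw [EuclideanSpace.real_norm_sq_eq, Fin.sum_univ_two]
  simp [frame]
  linear_combination (z.1 ^ 2 + z.2 ^ 2) * h

variable {a b : ℝ}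

lemma frame_mem_annulus_iff (hv : ‖v‖ = 1) (ha : 0 < a) (hb : 0 < b) (z : ℝ × ℝ) :
    frame v z ∈ annulus a b ↔ a ^ 2 ≤ z.1 ^ 2 + z.2 ^ 2 ∧ z.1 ^ 2 + z.2 ^ 2 ≤ b ^ 2 := by
  rw [← norm_sq_frame hv, sq_le_sq₀ ha.le (norm_nonneg _), sq_le_sq₀ (norm_nonneg _) hb.le]
  rfl

/-- Paths in a strip give paths in a sublevel set of the annulus. -/
lemma joinedIn_sublevel_of_strip (hv : ‖v‖ = 1) (ha : 0 < a) (hb : 0 < b) {g : ℝ → ℝ} {r : ℝ}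
    {x y : annulus a b} {z w : ℝ × ℝ} (hx : frame v z = x) (hy : frame v w = y)
    (h : JoinedIn (strip a b {p | g p ≤ r}) z w) :
    JoinedIn (sublevel (fun x : annulus a b => g (inner ℝ (x : EuclideanSpace ℝ (Fin 2)) v)) r)
      x y := by
  have key : ∀ u ∈ strip a b {p | g p ≤ r}, ∀ hu : frame v u ∈ annulus a b,
      (⟨frame v u, hu⟩ : annulus a b) ∈
        sublevel (fun x : annulus a b => g (inner ℝ (x : EuclideanSpace ℝ (Fin 2)) v)) r := by
    intro u hu hu'
    refine mem_sublevel ?_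
    simp only [inner_frame hv]
    exact hu.2
  have hx' : x ∈
      sublevel (fun x : annulus a b => g (inner ℝ (x : EuclideanSpace ℝ (Fin 2)) v)) r := by
    obtain ⟨x, hxm⟩ := x
    obtain rfl : frame v z = x := hx
    exact key z h.source_mem hxm
  have hy' : y ∈
      sublevel (fun x : annulus a b => g (inner ℝ (x : EuclideanSpace ℝ (Fin 2)) v)) r := by
    obtain ⟨y, hym⟩ := y
    obtain rfl : frame v w = y := hy
    exact key w h.target_mem hym
  -- Paths in the annulus as a subtype correspond to paths in the plane with image inside it.
  rw [← Topology.IsInducing.subtypeVal.joinedIn_image hx' hy', ← hx, ← hy]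
  refine (h.map (continuous_frame v)).mono ?_
  rintro _ ⟨u, hu, rfl⟩
  have hum := (frame_mem_annulus_iff hv ha hb u).2 hu.1
  exact ⟨⟨frame v u, hum⟩, key u hu hum, rfl⟩

/-- The point of the annulus with coordinates `z` in the frame with first axis `v`. -/
def annulusPoint (hv : ‖v‖ = 1) (ha : 0 < a) (hab : a < b) (z : ℝ × ℝ)
    (hz : z.1 ^ 2 + z.2 ^ 2 = b ^ 2) : annulus a b :=
  ⟨frame v z, (frame_mem_annulus_iff hv ha (ha.trans hab) z).2
    ⟨hz ▸ pow_le_pow_left₀ ha.le hab.le 2, hz.le⟩⟩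

lemma mem_strip_coordinates (hv : ‖v‖ = 1) (ha : 0 < a) (hb : 0 < b) {I : Set ℝ}
    (x : annulus a b) (hx : inner ℝ (x : EuclideanSpace ℝ (Fin 2)) v ∈ I) :
    (inner ℝ (x : EuclideanSpace ℝ (Fin 2)) v, coheight v x) ∈ strip a b I := by
  refine ⟨(frame_mem_annulus_iff hv ha hb _).1 ?_, hx⟩
  rw [frame_inner_coheight hv]
  exact x.2

variable (K : Type u) [Field K]

theorem card_PD_height_annulus (hv : ‖v‖ = 1) (ha : 0 < a) (hab : a < b) :
    (PD K (fun x : annulus a b => inner ℝ (x : EuclideanSpace ℝ (Fin 2)) v) 0).points.card = 1 := by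
  have hb := ha.trans hab
  rw [(isPersistenceDiagram_zero_of_joinedIn
    (e := annulusPoint hv ha hab (-b, 0) (by simp)) fun y => ?_).PD_eq]
  · rfl
  · refine JoinedIn.symm (joinedIn_sublevel_of_strip (g := id) hv ha hb
      (frame_inner_coheight hv y) rfl ?_)
    exact joinedIn_strip_Iic hb (mem_strip_coordinates hv ha hb y Set.self_mem_Iic)

theorem card_PD_abs_height_annulus (hv : ‖v‖ = 1) (ha : 0 < a) (hab : a < b) :
    (PD K (fun x : annulus a b => |inner ℝ (x : EuclideanSpace ℝ (Fin 2)) v|) 0).points.card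
      = 2 := by
  have hb := ha.trans hab
  set e₀ : annulus a b := annulusPoint hv ha hab (0, b) (by simp)
  set e₁ : annulus a b := annulusPoint hv ha hab (0, -b) (by simp)
  have hset : ∀ r : ℝ, {p : ℝ | |p| ≤ r} = Set.Icc (-r) r := fun r => by
    ext p
    exact abs_le (a := p) (b := r)
  have h₀ : inner ℝ (e₀ : EuclideanSpace ℝ (Fin 2)) v = 0 := inner_frame hv _
  have h₁ : inner ℝ (e₁ : EuclideanSpace ℝ (Fin 2)) v = 0 := inner_frame hv _
  have key := isPersistenceDiagram_zero_of_merge (K := K) (a := a) (e₀ := e₀) (e₁ := e₁)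
    (f := fun x : annulus a b => |inner ℝ (x : EuclideanSpace ℝ (Fin 2)) v|)
  refine (congrArg (fun D : PersistenceDiagram => D.points.card)
    (key ?_ ?_ (fun y => ?_) ?_ fun r hr h => ?_).PD_eq).trans rfl
  · simp only [h₀, h₁]
  · simpa only [h₀, abs_zero] using ha
  · have hmem := mem_strip_coordinates hv ha hb (I := Set.Icc
      (-|inner ℝ (y : EuclideanSpace ℝ (Fin 2)) v|) |inner ℝ (y : EuclideanSpace ℝ (Fin 2)) v|) y
      (abs_le.1 le_rfl)
    rcases le_total 0 (coheight v y) with hq | hq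
    · refine Or.inl (JoinedIn.symm (joinedIn_sublevel_of_strip (g := abs) hv ha hb
        (frame_inner_coheight hv y) rfl ?_))
      rw [hset]
      exact joinedIn_strip_Icc hb hmem hq
    · refine Or.inr (JoinedIn.symm (joinedIn_sublevel_of_strip (g := abs) hv ha hb
        (frame_inner_coheight hv y) rfl ?_))
      rw [hset]
      exact joinedIn_strip_Icc_neg hb hmem hq
  · refine joinedIn_sublevel_of_strip (z := (0, b)) (w := (0, -b)) (g := abs) hv ha hb rfl rfl ?_
    rw [hset]
    -- The two halves meet at this point of the inner circle, reached exactly at level `a`.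
    have hmem : (a, (0 : ℝ)) ∈ strip a b (Set.Icc (-a) a) :=
      ⟨⟨by simp, by simpa using pow_le_pow_left₀ ha.le hab.le 2⟩, by linarith, le_rfl⟩
    exact (joinedIn_strip_Icc hb hmem le_rfl).symm.trans
      (joinedIn_strip_Icc_neg hb hmem le_rfl)
  · obtain ⟨γ, hγ⟩ := h
    have hc : Continuous fun t => coheight v (γ t : annulus a b) :=
      (continuous_coheight v).comp (continuous_subtype_val.comp γ.continuous)
    have e0 : coheight v (e₀ : EuclideanSpace ℝ (Fin 2)) = b := coheight_frame hv _
    have e1 : coheight v (e₁ : EuclideanSpace ℝ (Fin 2)) = -b := coheight_frame hv _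
    -- A path between the two points has coheight 0 somewhere; there the norm is the absolute
    -- height, so it is at least `a > r`.
    obtain ⟨t, ht⟩ := mem_range_of_exists_le_of_exists_ge (c := (0 : ℝ)) hc
      ⟨1, by rw [γ.target, e1]; linarith⟩ ⟨0, by rw [γ.source, e0]; exact hb.le⟩
    have hle : |inner ℝ ((γ t : annulus a b) : EuclideanSpace ℝ (Fin 2)) v| ≤ r := hγ t
    have hs := (mem_strip_coordinates hv ha hb (I := Set.univ) (γ t) trivial).1.1
    simp only at ht hs
    rw [ht, zero_pow two_ne_zero, add_zero, ← sq_abs (inner ℝ _ v)] at hs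
    have := abs_le_of_sq_le_sq' hs (abs_nonneg _)
    linarith [this.2]

end Annulus

/-! ### Definability of the annulus -/

section Definable

/-- A real number is nonnegative exactly when it is a square, so the set is the projection of an
algebraic set in one more variable. The sign `s = 1` gives the outside of a circle and `s = -1` a
disc. -/
lemma definable_of_iff_exists_sq (S : OMinimalStructure) {A : Set (Fin 2 → ℝ)} (s : ℝ) (c : ℝ)
    (hA : ∀ x, x ∈ A ↔ 0 ≤ s * (x 0 ^ 2 + x 1 ^ 2 - c)) : A ∈ S.definable 2 := by
  let P : MvPolynomial (Fin 3) ℝ := MvPolynomial.C s *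
    (MvPolynomial.X 0 ^ 2 + MvPolynomial.X 1 ^ 2 - MvPolynomial.C c) - MvPolynomial.X 2 ^ 2
  have h := S.proj_mem 2 (by norm_num) _ (S.algebraic_mem 3 (by norm_num) {P})
  convert h using 1
  ext x
  rw [hA]
  constructor
  · intro hx
    refine ⟨![x 0, x 1, √(s * (x 0 ^ 2 + x 1 ^ 2 - c))], ?_, ?_⟩
    · intro p hp
      rw [Finset.mem_singleton.1 hp]
      simp [P, Real.sq_sqrt hx]
    · ext i
      fin_cases i <;> rfl
  · rintro ⟨y, hy, rfl⟩
    have := hy P (Finset.mem_singleton_self P)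
    simp [P, sub_eq_zero] at this
    change 0 ≤ s * (y 0 ^ 2 + y 1 ^ 2 - c)
    rw [this]
    positivity

theorem isConstructible_annulus (S : OMinimalStructure) {a b : ℝ} (ha : 0 < a) (hab : a < b) :
    IsConstructible S (annulus a b) := by
  constructor
  · have h1 := definable_of_iff_exists_sq S
      (A := {x : Fin 2 → ℝ | a ≤ ‖WithLp.toLp 2 x‖}) 1 (a ^ 2) fun x => by
        rw [Set.mem_ofPred_eq, ← sq_le_sq₀ ha.le (norm_nonneg _), EuclideanSpace.real_norm_sq_eq,
          Fin.sum_univ_two, one_mul, sub_nonneg]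
    have h2 := definable_of_iff_exists_sq S
      (A := {x : Fin 2 → ℝ | ‖WithLp.toLp 2 x‖ ≤ b}) (-1) (b ^ 2) fun x => by
        rw [Set.mem_ofPred_eq, ← sq_le_sq₀ (norm_nonneg _) (ha.trans hab).le,
          EuclideanSpace.real_norm_sq_eq, Fin.sum_univ_two, neg_one_mul, neg_sub, sub_nonneg]
    exact S.inter_mem 2 (by norm_num) _ h1 _ h2
  · have : annulus a b = Metric.closedBall 0 b ∩ {x | a ≤ ‖x‖} := by
      ext x
      rw [Set.mem_inter_iff, mem_closedBall_zero_iff]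
      exact and_comm
    rw [this]
    exact (isCompact_closedBall 0 b).inter_right (isClosed_le continuous_const continuous_norm)

end Definable

/-! ### Strictness for the annulus, and the main theorem -/

/-- The distances from a line through the origin separate the two halves of the annulus, which no
height function does. -/
theorem heightPHT_annulus_notMem (K : Type u) [Field K] {a b : ℝ} (ha : 0 < a) (hab : a < b)
    (M : ℝ) {v : EuclideanSpace ℝ (Fin 2)} (hv : ‖v‖ = 1) :
    heightPHT K (annulus a b) (hyperplanePoint 0 hv) ∉
      translateTuple M '' Set.range (classicalPHT K (annulus a b)) := by
  rintro ⟨_, ⟨w, rfl⟩, hw⟩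
  have h := congrArg (fun D : PersistenceDiagram => D.points.card) (congrFun hw 0)
  have h1 : ((PD K (fun x : annulus a b => inner ℝ (x : EuclideanSpace ℝ (Fin 2)) w) 0).points.map
      (translatePoint M)).card = 1 := by
    rw [Multiset.card_map]
    exact card_PD_height_annulus K (norm_eq_of_mem_sphere w) ha hab
  have h2 : (heightPHT K (annulus a b) (hyperplanePoint 0 hv) 0).points.card = 2 := by
    rw [heightPHT_hyperplanePoint]
    simp only [sub_zero]
    exact card_PD_abs_height_annulus K hv ha hab
  exact absurd (h1.symm.trans (h.trans h2)) (by norm_num)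

end PersistentHomologyTransform

end

theorem mainTheorem5 {K : Type*} [Field K] (S : PersistentHomologyTransform.OMinimalStructure) :
    (∀ (n : ℕ), 1 ≤ n → ∀ X : Set (EuclideanSpace ℝ (Fin n)),
      PersistentHomologyTransform.IsConstructible S X →
        (∃ M : ℝ, 0 < M ∧ X ⊆ Metric.ball 0 M) ∧
        ∀ M : ℝ, 0 < M → X ⊆ Metric.ball 0 M →
          Function.Injective (PersistentHomologyTransform.translateTuple (n := n) M) ∧
          PersistentHomologyTransform.translateTuple M ''
              Set.range (PersistentHomologyTransform.classicalPHT K X) ⊆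
            Set.range (PersistentHomologyTransform.heightPHT K X)) ∧
    (∀ a b : ℝ, 0 < a → a < b →
      PersistentHomologyTransform.IsConstructible S (PersistentHomologyTransform.annulus a b) ∧
      ∀ M : ℝ, 0 < M → PersistentHomologyTransform.annulus a b ⊆ Metric.ball 0 M →
        PersistentHomologyTransform.translateTuple M ''
            Set.range (PersistentHomologyTransform.classicalPHT K
              (PersistentHomologyTransform.annulus a b)) ⊂
          Set.range (PersistentHomologyTransform.heightPHT K
            (PersistentHomologyTransform.annulus a b))) := by 
  refine ⟨fun n _ X hX => ⟨?_, fun M _ hM => ⟨?_, ?_⟩⟩, fun a b ha hab => ⟨?_, fun M _ hM => ?_⟩⟩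
  · obtain ⟨M, hM, h⟩ := hX.2.isBounded.subset_ball_lt 0 0
    exact ⟨M, hM, h⟩
  · exact PersistentHomologyTransform.translateTuple_injective M
  · exact PersistentHomologyTransform.translateTuple_image_range_classicalPHT_subset K hM
  · exact PersistentHomologyTransform.isConstructible_annulus S ha hab
  · have hv : ‖(EuclideanSpace.single 0 1 : EuclideanSpace ℝ (Fin 2))‖ = 1 := by simp
    refine (Set.ssubset_iff_of_subset
      (PersistentHomologyTransform.translateTuple_image_range_classicalPHT_subset K hM)).2 ?_
    exact ⟨_, ⟨PersistentHomologyTransform.hyperplanePoint 0 hv, rfl⟩,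
      PersistentHomologyTransform.heightPHT_annulus_notMem K ha hab M hv⟩
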